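/- Let $\mathbb{K}=\mathbb{R}$ or $\mathbb{C}$. A Poisson structure on a smooth, real analytic or complex manifold $M$ is a bivector field $\pi$ of the same regularity whose bracket $\{a,b\}=\pi(da,db)$ on local functions satisfies the Jacobi identity; it is symplectic if $\pi$ is invertible at every point. A symplectic resolution of a Poisson manifold $(M,\pi)$ is a triple $(\Sigma,\Pi,\varphi)$, where $\Sigma$ is a Hausdorff manifold with $\dim\Sigma=\dim M$, $\Pi$ is a symplectic Poisson structure on $\Sigma$, and $\varphi:\Sigma\to M$ is a surjective Poisson morphism, i.e. $\Pi_\sigma(\varphi^*\alpha,\varphi^*\beta)=\pi_{\varphi(\sigma)}(\alpha,\beta)$ for all $\sigma\in\Sigma$ and $\alpha,\beta\in T^*_{\varphi(\sigma)}M$. The resolution is called smooth, real analytic or holomorphic when $\Sigma$, $\Pi$ and $\varphi$ are; it is proper if the inverse image under $\varphi$ of every compact set is compact, and connected if $\Sigma$ is connected. (1) Let $g:\mathbb{R}^2\to\mathbb{R}$ be a smooth function with $g(x,y)\neq 0$ whenever $x\neq 0$, and equip $\mathbb{R}^2$ with the Poisson structure $\{x,y\}=f(x,y)=x\,g(x,y)$.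 Then $(\mathbb{R}^2,\{\cdot,\cdot\})$ admits no proper smooth symplectic resolution. (2) If moreover $f$ is real analytic, then $(\mathbb{R}^2,\{\cdot,\cdot\})$ admits no connected, second countable, real analytic symplectic resolution. (3) Let $U\subset\mathbb{C}^2$ be an open set containing $(0,0)$, and let $f(x,y)=x\,g(x,y)$ be a holomorphic function on $U$, where $g(x,y)\neq 0$ for every $(x,y)\in U$ with $x\neq 0$. Then $U$ with the holomorphic Poisson structure $\{x,y\}=f(x,y)$ admits no connected, second countable, holomorphic symplectic resolution. -/

import Mathlib

open scoped Manifold ContDiff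

universe u v w

namespace PoissonGeometry

section General

variable {𝕜 : Type u} [RCLike 𝕜]

/-- The cotangent space `T*_x M` of a manifold modelled on the normed space `E`. -/
abbrev Cotangent (𝕜 : Type u) [RCLike 𝕜] (E : Type v) [NormedAddCommGroup E] [NormedSpace 𝕜 E]
    {M : Type w} [TopologicalSpace M] [ChartedSpace E M] (x : M) : Type _ :=
  TangentSpace 𝓘(𝕜, E) x →L[𝕜] 𝕜

/-- A (not necessarily regular) bivector field on `M`: a skew-symmetric bilinear form on each
cotangent space. -/
structure BivectorField (𝕜 : Type u) [RCLike 𝕜] (E : Type v) [NormedAddCommGroup E]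
    [NormedSpace 𝕜 E] (M : Type w) [TopologicalSpace M] [ChartedSpace E M] where
  /-- The bilinear form at the point `x`. -/
  form : ∀ x : M, Cotangent 𝕜 E x →ₗ[𝕜] Cotangent 𝕜 E x →ₗ[𝕜] 𝕜
  isAlt : ∀ x : M, (form x).IsAlt

variable {E : Type v} [NormedAddCommGroup E] [NormedSpace 𝕜 E]
  {M : Type w} [TopologicalSpace M] [ChartedSpace E M]

/-- The bracket `{a, b}(x) = π_x(d_x a, d_x b)`. -/
noncomputable def BivectorField.bracket (π : BivectorField 𝕜 E M) (a b : M → 𝕜) (x : M) : 𝕜 :=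
  π.form x (mvfderiv 𝓘(𝕜, E) a x) (mvfderiv 𝓘(𝕜, E) b x)

/-- `π` is a Poisson structure of class `C^n` (meant for `n = ∞`: smooth, and `n = ω`: real
analytic or holomorphic, according to `𝕜`): the bracket of two `C^n` functions on an open set is
`C^n` on that set, and it satisfies the Jacobi identity. Local functions are used because there
may be few global analytic functions. -/
structure BivectorField.IsPoisson (n : WithTop ℕ∞) (π : BivectorField 𝕜 E M) : Prop where
  contMDiffOn_bracket : ∀ V : Set M, IsOpen V → ∀ a b : M → 𝕜,
    ContMDiffOn 𝓘(𝕜, E) 𝓘(𝕜, 𝕜) n a V → ContMDiffOn 𝓘(𝕜, E) 𝓘(𝕜, 𝕜) n b V →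
    ContMDiffOn 𝓘(𝕜, E) 𝓘(𝕜, 𝕜) n (π.bracket a b) V
  jacobi : ∀ V : Set M, IsOpen V → ∀ a b c : M → 𝕜,
    ContMDiffOn 𝓘(𝕜, E) 𝓘(𝕜, 𝕜) n a V → ContMDiffOn 𝓘(𝕜, E) 𝓘(𝕜, 𝕜) n b V →
    ContMDiffOn 𝓘(𝕜, E) 𝓘(𝕜, 𝕜) n c V → ∀ x ∈ V,
    π.bracket a (π.bracket b c) x + π.bracket b (π.bracket c a) x
      + π.bracket c (π.bracket a b) x = 0

/-- `π` is a symplectic Poisson structure of class `C^n`: a Poisson structure that is invertible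
at every point. -/
structure BivectorField.IsSymplectic (n : WithTop ℕ∞) (π : BivectorField 𝕜 E M) : Prop where
  isPoisson : π.IsPoisson n
  nondegenerate : ∀ x : M, (π.form x).Nondegenerate

/-- `(S, ϖ, φ)` is a symplectic resolution of class `C^n` of `(M, π)`: `(S, ϖ)` is symplectic of
the same dimension as `M`, and `φ : S → M` is a surjective Poisson morphism, that is, a `C^n` map
with `ϖ_s (φ^* α, φ^* β) = π_{φ s} (α, β)`. -/
structure IsSymplecticResolution (n : WithTop ℕ∞) (π : BivectorField 𝕜 E M)
    {F : Type*} [NormedAddCommGroup F] [NormedSpace 𝕜 F]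
    {S : Type*} [TopologicalSpace S] [ChartedSpace F S]
    (ϖ : BivectorField 𝕜 F S) (φ : S → M) : Prop where
  finrank_eq : Module.finrank 𝕜 F = Module.finrank 𝕜 E
  isSymplectic : ϖ.IsSymplectic n
  contMDiff : ContMDiff 𝓘(𝕜, F) 𝓘(𝕜, E) n φ
  form_comp : ∀ (s : S) (α β : Cotangent 𝕜 E (φ s)),
    ϖ.form s (α.comp (mfderiv 𝓘(𝕜, F) 𝓘(𝕜, E) φ s)) (β.comp (mfderiv 𝓘(𝕜, F) 𝓘(𝕜, E) φ s))
      = π.form (φ s) α β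
  surjective : Function.Surjective φ

end General

section Planar

variable {𝕜 : Type u} [RCLike 𝕜] {M : Type w} [TopologicalSpace M] [ChartedSpace (𝕜 × 𝕜) M]

/-- The coordinate vector `∂_x = (1, 0)` in `T_z M = 𝕜²`. -/
def coordX (𝕜 : Type u) [RCLike 𝕜] {M : Type w} [TopologicalSpace M] [ChartedSpace (𝕜 × 𝕜) M]
    (z : M) : TangentSpace 𝓘(𝕜, 𝕜 × 𝕜) z :=
  ((1, 0) : 𝕜 × 𝕜)

/-- The coordinate vector `∂_y = (0, 1)` in `T_z M = 𝕜²`. -/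
def coordY (𝕜 : Type u) [RCLike 𝕜] {M : Type w} [TopologicalSpace M] [ChartedSpace (𝕜 × 𝕜) M]
    (z : M) : TangentSpace 𝓘(𝕜, 𝕜 × 𝕜) z :=
  ((0, 1) : 𝕜 × 𝕜)

/-- The bivector field `f ∂_x ∧ ∂_y`. It is used for `M = 𝕜²` and for open subsets `M` of `𝕜²`,
whose charts are the identity and the inclusion; there it satisfies `{x, y} = f`, see
`planarBivector_bracket_coord` and `planarBivector_bracket_coord_opens`. -/
noncomputable def planarBivector (f : M → 𝕜) : BivectorField 𝕜 (𝕜 × 𝕜) M where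
  form z := LinearMap.mk₂ 𝕜
    (fun α β : Cotangent 𝕜 (𝕜 × 𝕜) z =>
      f z * (α (coordX 𝕜 z) * β (coordY 𝕜 z) - α (coordY 𝕜 z) * β (coordX 𝕜 z)))
    (fun α₁ α₂ β => by simp only [add_apply]; ring)
    (fun c α β => by simp only [smul_apply, smul_eq_mul]; ring)
    (fun α β₁ β₂ => by simp only [add_apply]; ring)
    (fun c α β => by simp only [smul_apply, smul_eq_mul]; ring)
  isAlt z α := by simp only [LinearMap.mk₂_apply]; ring

theorem planarBivector_bracket (f a b : M → 𝕜) (z : M) :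
    (planarBivector f).bracket a b z =
      f z * (mvfderiv 𝓘(𝕜, 𝕜 × 𝕜) a z (coordX 𝕜 z) * mvfderiv 𝓘(𝕜, 𝕜 × 𝕜) b z (coordY 𝕜 z)
        - mvfderiv 𝓘(𝕜, 𝕜 × 𝕜) a z (coordY 𝕜 z) * mvfderiv 𝓘(𝕜, 𝕜 × 𝕜) b z (coordX 𝕜 z)) :=
  rfl

theorem planarBivector_bracket_coord (f : 𝕜 × 𝕜 → 𝕜) (z : 𝕜 × 𝕜) :
    (planarBivector f).bracket Prod.fst Prod.snd z = f z := by
  have h1 : mvfderiv 𝓘(𝕜, 𝕜 × 𝕜) (Prod.fst : 𝕜 × 𝕜 → 𝕜) z = ContinuousLinearMap.fst 𝕜 𝕜 𝕜 := by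
    rw [mvfderiv, mfderiv_eq_fderiv, fderiv_fst]; rfl
  have h2 : mvfderiv 𝓘(𝕜, 𝕜 × 𝕜) (Prod.snd : 𝕜 × 𝕜 → 𝕜) z = ContinuousLinearMap.snd 𝕜 𝕜 𝕜 := by
    rw [mvfderiv, mfderiv_eq_fderiv, fderiv_snd]; rfl
  have e : (planarBivector f).bracket Prod.fst Prod.snd z
      = f z * ((1 : 𝕜) * 1 - 0 * 0) := by
    rw [planarBivector_bracket, h1, h2]; rfl
  rw [e]; ring

theorem planarBivector_bracket_coord_opens (U : TopologicalSpace.Opens (𝕜 × 𝕜)) (f : U → 𝕜)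
    (z : U) :
    (planarBivector f).bracket (fun p : U => (p : 𝕜 × 𝕜).1) (fun p : U => (p : 𝕜 × 𝕜).2) z
      = f z := by
  have hc : (chartAt (𝕜 × 𝕜) z : U → 𝕜 × 𝕜) = Subtype.val := rfl
  have hev : ∀ᶠ p in nhds (z : 𝕜 × 𝕜), ((chartAt (𝕜 × 𝕜) z).symm p : 𝕜 × 𝕜) = p := by
    have : (chartAt (𝕜 × 𝕜) z).target ∈ nhds (chartAt (𝕜 × 𝕜) z z) :=
      chart_target_mem_nhds (𝕜 × 𝕜) z
    filter_upwards [this] with p hp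
    exact (chartAt (𝕜 × 𝕜) z).right_inv hp
  have key : ∀ L : 𝕜 × 𝕜 →L[𝕜] 𝕜,
      mvfderiv 𝓘(𝕜, 𝕜 × 𝕜) (fun p : U => L (p : 𝕜 × 𝕜)) z = L := by
    intro L
    have hd : HasMFDerivAt 𝓘(𝕜, 𝕜 × 𝕜) 𝓘(𝕜, 𝕜) (fun p : U => L (p : 𝕜 × 𝕜)) z L := by
      refine ⟨(L.continuous.comp continuous_subtype_val).continuousAt, ?_⟩
      refine HasFDerivAt.hasFDerivWithinAt ?_
      refine L.hasFDerivAt.congr_of_eventuallyEq ?_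
      filter_upwards [hev] with p hp
      change L (((chartAt (𝕜 × 𝕜) z).symm p : U) : 𝕜 × 𝕜) = L p
      rw [hp]
    rw [mvfderiv, hd.mfderiv]; rfl
  have e : (planarBivector f).bracket (fun p : U => (p : 𝕜 × 𝕜).1) (fun p : U => (p : 𝕜 × 𝕜).2) z
      = f z * ((1 : 𝕜) * 1 - 0 * 0) := by
    rw [planarBivector_bracket]
    have h1 := key (ContinuousLinearMap.fst 𝕜 𝕜 𝕜)
    have h2 := key (ContinuousLinearMap.snd 𝕜 𝕜 𝕜)
    simp only [ContinuousLinearMap.coe_fst', ContinuousLinearMap.coe_snd'] at h1 h2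
    rw [h1, h2]; rfl
  rw [e]; ring

end Planar

end PoissonGeometry

/-! Write `φ = (X, Y)` and `f = x g`. Since `φ` is Poisson, `{X, Y} = f ∘ φ`. In a chart with
coordinates `(u, v)` this reads `h · Jac(X, Y) = f(X, Y)`, where `h = {u, v}` has no zeros because
the structure is symplectic (`exists_chart_jacobian_eq`).

Proper case: on compact sets `|Jac| ≤ C |X|`, so the part where `0 < X ≤ ε` has image of area at
most `C ε` times its own area. These parts shrink to the empty set as `ε → 0`, so the image has area
`o(ε)`. By properness finitely many charts cover the preimage of the unit square, whose image must
contain `(0, ε] × [0, 1]`, of area `ε`: a contradiction.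

Analytic cases: by connectedness and surjectivity `X` vanishes identically on no open set, so at a
zero it has a finite order `k + 1`. Some derivative `D = ∂_l X` of order `k` then has `D = 0` and
`dD ≠ 0` there. Since `f` vanishes on `x = 0`, `f(X, Y)` vanishes to order `k + 1` too, and applying
`∂_l` to the Jacobian equation leaves only its lowest order term `Jac(D, Y) = 0`
(`jacobian_wordDeriv_eq_zero`). So `Y` is critical along the regular curve `D = 0` at that point,
and one-dimensional Sard makes its values there null (`addHaar_image_curve_eq_zero`). There are
countably many words `l` and countably many charts, so `Y(X = 0)` is null. By surjectivity it
contains a nonempty open subset of the line `x = 0`: a contradiction. -/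

namespace PoissonGeometry

/-! ### Iterated partial derivatives and order of vanishing -/

section Words

variable {𝕜 : Type*} [RCLike 𝕜]

/-- The standard basis vectors of `𝕜²`. -/
def stdVec (𝕜 : Type*) [RCLike 𝕜] (i : Bool) : 𝕜 × 𝕜 := if i then (1, 0) else (0, 1)

/-- The iterated partial derivative of `a` along the word `l`, the head being applied first. -/
noncomputable def wordDeriv : List Bool → (𝕜 × 𝕜 → 𝕜) → 𝕜 × 𝕜 → 𝕜
  | [], a => a
  | i :: l, a => wordDeriv l fun z => fderiv 𝕜 a z (stdVec 𝕜 i)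

/-- All iterated partial derivatives of `a` of order `< k` vanish at `p`. -/
def VanishesToOrder (k : ℕ) (a : 𝕜 × 𝕜 → 𝕜) (p : 𝕜 × 𝕜) : Prop :=
  ∀ l : List Bool, l.length < k → wordDeriv l a p = 0

/-- The Jacobian determinant of the map `(a, b)`. -/
noncomputable def jacobian (a b : 𝕜 × 𝕜 → 𝕜) (z : 𝕜 × 𝕜) : 𝕜 :=
  fderiv 𝕜 a z (stdVec 𝕜 true) * fderiv 𝕜 b z (stdVec 𝕜 false)
    - fderiv 𝕜 a z (stdVec 𝕜 false) * fderiv 𝕜 b z (stdVec 𝕜 true)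

theorem wordDeriv_append_singleton (l : List Bool) (i : Bool) (a : 𝕜 × 𝕜 → 𝕜) :
    wordDeriv (l ++ [i]) a = fun z => fderiv 𝕜 (wordDeriv l a) z (stdVec 𝕜 i) := by
  induction l generalizing a with
  | nil => rfl
  | cons j l ih => exact ih _

theorem clm_apply_eq_stdVec (A : 𝕜 × 𝕜 →L[𝕜] 𝕜) (x : 𝕜 × 𝕜) :
    A x = x.1 * A (stdVec 𝕜 true) + x.2 * A (stdVec 𝕜 false) := by
  have e : x = x.1 • stdVec 𝕜 true + x.2 • stdVec 𝕜 false := by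
    ext <;> simp [stdVec]
  conv_lhs => rw [e, map_add, map_smul, map_smul, smul_eq_mul, smul_eq_mul]

variable {O : Set (𝕜 × 𝕜)} {a b : 𝕜 × 𝕜 → 𝕜} {p : 𝕜 × 𝕜}

theorem contDiffOn_fderiv_apply (hO : IsOpen O) (ha : ContDiffOn 𝕜 ∞ a O) (v : 𝕜 × 𝕜) :
    ContDiffOn 𝕜 ∞ (fun z => fderiv 𝕜 a z v) O :=
  (ha.fderiv_of_isOpen hO (by simp)).clm_apply contDiffOn_const

theorem contDiffOn_wordDeriv (hO : IsOpen O) (l : List Bool) (ha : ContDiffOn 𝕜 ∞ a O) :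
    ContDiffOn 𝕜 ∞ (wordDeriv l a) O := by
  induction l generalizing a with
  | nil => exact ha
  | cons i l ih => exact ih (contDiffOn_fderiv_apply hO ha _)

theorem wordDeriv_congr (hO : IsOpen O) (h : Set.EqOn a b O) (l : List Bool) :
    Set.EqOn (wordDeriv l a) (wordDeriv l b) O := by
  induction l generalizing a b with
  | nil => exact h
  | cons i l ih =>
    refine ih fun z hz => ?_
    have : a =ᶠ[nhds z] b := Filter.eventuallyEq_of_mem (hO.mem_nhds hz) h
    simp only [this.fderiv_eq]

theorem wordDeriv_add (hO : IsOpen O) (ha : ContDiffOn 𝕜 ∞ a O) (hb : ContDiffOn 𝕜 ∞ b O)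
    (l : List Bool) {z : 𝕜 × 𝕜} (hz : z ∈ O) :
    wordDeriv l (fun z => a z + b z) z = wordDeriv l a z + wordDeriv l b z := by
  induction l generalizing a b with
  | nil => rfl
  | cons i l ih =>
    have key : Set.EqOn (fun z => fderiv 𝕜 (fun z => a z + b z) z (stdVec 𝕜 i))
        (fun z => fderiv 𝕜 a z (stdVec 𝕜 i) + fderiv 𝕜 b z (stdVec 𝕜 i)) O := by
      intro y hy
      have h1 := (ha.contDiffAt (hO.mem_nhds hy)).differentiableAt (by simp)
      have h2 := (hb.contDiffAt (hO.mem_nhds hy)).differentiableAt (by simp)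
      simp only [fderiv_fun_add h1 h2, add_apply]
    exact (wordDeriv_congr hO key l hz).trans
      (ih (contDiffOn_fderiv_apply hO ha _) (contDiffOn_fderiv_apply hO hb _))

theorem VanishesToOrder.mono {j k : ℕ} (h : VanishesToOrder k a p) (hjk : j ≤ k) :
    VanishesToOrder j a p := fun l hl => h l (hl.trans_le hjk)

theorem VanishesToOrder.fderiv_apply {k : ℕ} (h : VanishesToOrder (k + 1) a p) (i : Bool) :
    VanishesToOrder k (fun z => fderiv 𝕜 a z (stdVec 𝕜 i)) p :=
  fun l hl => h (i :: l) (by simpa using hl)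

/-- Leibniz rule for the lowest order term: if `a` vanishes to order `|l|` at `p`, then only
the term in which all derivatives fall on `a` survives. -/
theorem wordDeriv_mul (hO : IsOpen O) (hp : p ∈ O) (ha : ContDiffOn 𝕜 ∞ a O)
    (hb : ContDiffOn 𝕜 ∞ b O) (l : List Bool) (h : VanishesToOrder l.length a p) :
    wordDeriv l (fun z => a z * b z) p = wordDeriv l a p * b p := by
  induction l generalizing a b with
  | nil => rfl
  | cons i l ih =>
    have key : Set.EqOn (fun z => fderiv 𝕜 (fun z => a z * b z) z (stdVec 𝕜 i))
        (fun z => fderiv 𝕜 a z (stdVec 𝕜 i) * b z + a z * fderiv 𝕜 b z (stdVec 𝕜 i)) O := by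
      intro y hy
      have h1 := (ha.contDiffAt (hO.mem_nhds hy)).differentiableAt (by simp)
      have h2 := (hb.contDiffAt (hO.mem_nhds hy)).differentiableAt (by simp)
      simp only [fderiv_fun_mul h1 h2, add_apply, smul_apply, smul_eq_mul]
      ring
    have ha' := contDiffOn_fderiv_apply hO ha (stdVec 𝕜 i)
    have hb' := contDiffOn_fderiv_apply hO hb (stdVec 𝕜 i)
    -- This kills the term `a * ∂_i b`: only `|l|` derivatives are left for `a`, one fewer than its
    -- order of vanishing.
    have h0 : wordDeriv l a p = 0 := h l (by simp)
    have e := wordDeriv_congr hO key l hp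
    rw [wordDeriv_add hO (ha'.mul hb) (ha.mul hb') l hp, ih ha' hb (h.fderiv_apply i),
      ih ha hb' (h.mono (by simp)), h0, zero_mul, add_zero] at e
    exact e

theorem VanishesToOrder.mul {k : ℕ} (hO : IsOpen O) (hp : p ∈ O) (ha : ContDiffOn 𝕜 ∞ a O)
    (hb : ContDiffOn 𝕜 ∞ b O) (h : VanishesToOrder k a p) :
    VanishesToOrder k (fun z => a z * b z) p := fun l hl => by
  rw [wordDeriv_mul hO hp ha hb l (h.mono hl.le), h l hl, zero_mul]

/-- A function that vanishes on the line `x = 0` pulls back under `(a, b)` to a function that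
vanishes at least to the same order as `a`. -/
theorem VanishesToOrder.comp {U : Set (𝕜 × 𝕜)} (hU : IsOpen U) {f : 𝕜 × 𝕜 → 𝕜}
    (hf : ContDiffOn 𝕜 ∞ f U) (hf0 : ∀ z ∈ U, z.1 = 0 → f z = 0) (hO : IsOpen O) (hp : p ∈ O)
    (ha : ContDiffOn 𝕜 ∞ a O) (hb : ContDiffOn 𝕜 ∞ b O) (hab : ∀ z ∈ O, (a z, b z) ∈ U) {k : ℕ}
    (h : VanishesToOrder k a p) : VanishesToOrder k (fun z => f (a z, b z)) p := by
  induction k generalizing f with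
  | zero => intro l hl; simp at hl
  | succ k ih =>
    rintro (_ | ⟨i, l⟩) hl
    · exact hf0 _ (hab p hp) (h [] hl)
    have hl' : l.length < k := by simpa using hl
    have hmaps : Set.MapsTo (fun z => (a z, b z)) O U := hab
    have hab' : ContDiffOn 𝕜 ∞ (fun z => (a z, b z)) O := ha.prodMk hb
    have hfx := contDiffOn_fderiv_apply hU hf (stdVec 𝕜 true)
    have hfy := contDiffOn_fderiv_apply hU hf (stdVec 𝕜 false)
    -- The derivative of `f` tangent to the line `x = 0` vanishes on that line as well, so the
    -- induction hypothesis applies to `∂_y f`.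
    have hfy0 : ∀ z ∈ U, z.1 = 0 → fderiv 𝕜 f z (stdVec 𝕜 false) = 0 := by
      rintro ⟨x, y⟩ hz (rfl : x = 0)
      have hd := ((hf.contDiffAt (hU.mem_nhds hz)).differentiableAt (by simp)).hasFDerivAt
      have hc : HasFDerivAt (fun t : 𝕜 => ((0 : 𝕜), t)) (ContinuousLinearMap.inr 𝕜 𝕜 𝕜) y :=
        hasFDerivAt_prodMk_right _ _
      have h1 := (hd.comp y hc)
      have h2 : (f ∘ fun t : 𝕜 => ((0 : 𝕜), t)) =ᶠ[nhds y] fun _ => 0 := by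
        have : ∀ᶠ t in nhds y, ((0 : 𝕜), t) ∈ U :=
          (Continuous.prodMk_right (0 : 𝕜)).continuousAt.eventually (hU.mem_nhds hz)
        filter_upwards [this] with t ht using hf0 _ ht rfl
      have h3 := h1.congr_of_eventuallyEq h2.symm
      have h4 := h3.unique (hasFDerivAt_const (0 : 𝕜) y)
      simpa [stdVec] using DFunLike.congr_fun h4 1
    have key : Set.EqOn (fun z => fderiv 𝕜 (fun z => f (a z, b z)) z (stdVec 𝕜 i))
        (fun z => fderiv 𝕜 a z (stdVec 𝕜 i) * fderiv 𝕜 f (a z, b z) (stdVec 𝕜 true)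
          + fderiv 𝕜 f (a z, b z) (stdVec 𝕜 false) * fderiv 𝕜 b z (stdVec 𝕜 i)) O := by
      intro y hy
      have h1 := ((ha.contDiffAt (hO.mem_nhds hy)).differentiableAt (by simp)).hasFDerivAt
      have h2 := ((hb.contDiffAt (hO.mem_nhds hy)).differentiableAt (by simp)).hasFDerivAt
      have h3 := ((hf.contDiffAt (hU.mem_nhds (hab y hy))).differentiableAt (by simp)).hasFDerivAt
      have h4 : HasFDerivAt (fun z => f (a z, b z)) _ y := h3.comp y (h1.prodMk h2)
      simp only [h4.fderiv, ContinuousLinearMap.comp_apply, ContinuousLinearMap.prod_apply]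
      rw [clm_apply_eq_stdVec, mul_comm (fderiv 𝕜 b y (stdVec 𝕜 i))]
    have ha' := contDiffOn_fderiv_apply hO ha (stdVec 𝕜 i)
    have hb' := contDiffOn_fderiv_apply hO hb (stdVec 𝕜 i)
    have hfx' : ContDiffOn 𝕜 ∞ (fun z => fderiv 𝕜 f (a z, b z) (stdVec 𝕜 true)) O :=
      hfx.comp hab' hmaps
    have hfy' : ContDiffOn 𝕜 ∞ (fun z => fderiv 𝕜 f (a z, b z) (stdVec 𝕜 false)) O :=
      hfy.comp hab' hmaps
    refine (wordDeriv_congr hO key l hp).trans ?_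
    rw [wordDeriv_add hO (ha'.mul hfx') (hfy'.mul hb') l hp]
    -- In the chain rule each term has a factor vanishing to order `k`: `∂_i a` in one, `∂_y f ∘ (a,
    -- b)` in the other.
    have t1 := (h.fderiv_apply i).mul hO hp ha' hfx' l hl'
    have t3 := (ih hfy hfy0 (h.mono k.le_succ)).mul hO hp hfy' hb' l hl'
    exact (congrArg₂ (· + ·) t1 t3).trans (add_zero 0)

/-- Partial derivatives commute, so a derivative taken first may be taken last; the induction swaps
one pair at a time by symmetry of the second derivative. -/
theorem wordDeriv_fderiv_apply (hO : IsOpen O) (ha : ContDiffOn 𝕜 ∞ a O) (l : List Bool)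
    (i : Bool) {z : 𝕜 × 𝕜} (hz : z ∈ O) :
    wordDeriv l (fun z => fderiv 𝕜 a z (stdVec 𝕜 i)) z
      = fderiv 𝕜 (wordDeriv l a) z (stdVec 𝕜 i) := by
  induction l generalizing a with
  | nil => rfl
  | cons j l ih =>
    refine Eq.trans ?_ (ih (contDiffOn_fderiv_apply hO ha (stdVec 𝕜 j)))
    refine wordDeriv_congr hO (fun y hy => ?_) l hz
    have hy' := ha.contDiffAt (hO.mem_nhds hy)
    have h2 : (2 : WithTop ℕ∞) ≤ ∞ := WithTop.coe_le_coe.2 le_top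
    have hd : DifferentiableAt 𝕜 (fderiv 𝕜 a) y :=
      ((hy'.of_le h2).fderiv_right (m := 1) (by norm_num)).differentiableAt (by simp)
    have hs : IsSymmSndFDerivAt 𝕜 a y := hy'.isSymmSndFDerivAt (by simpa using h2)
    simp only [fderiv_clm_apply hd (differentiableAt_const _), fderiv_fun_const]
    simpa using hs (stdVec 𝕜 j) (stdVec 𝕜 i)

/-- If `a` vanishes to order `> k` at `p` and the Jacobian of `(a, b)` is a multiple of a
function vanishing on `x = 0`, then the differentials of `b` and of the derivatives of order `k`
of `a` are proportional at `p`. -/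
theorem jacobian_wordDeriv_eq_zero {U : Set (𝕜 × 𝕜)} (hU : IsOpen U) {f h : 𝕜 × 𝕜 → 𝕜}
    (hf : ContDiffOn 𝕜 ∞ f U) (hf0 : ∀ z ∈ U, z.1 = 0 → f z = 0) (hO : IsOpen O) (hp : p ∈ O)
    (ha : ContDiffOn 𝕜 ∞ a O) (hb : ContDiffOn 𝕜 ∞ b O) (hab : ∀ z ∈ O, (a z, b z) ∈ U)
    (hh : ContDiffOn 𝕜 ∞ h O) (hh0 : ∀ z ∈ O, h z ≠ 0)
    (hjac : ∀ z ∈ O, h z * jacobian a b z = f (a z, b z)) (l : List Bool)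
    (hl : VanishesToOrder (l.length + 1) a p) : jacobian (wordDeriv l a) b p = 0 := by
  have hfab : ContDiffOn 𝕜 ∞ (fun z => f (a z, b z)) O := hf.comp (ha.prodMk hb) hab
  have hh' : ContDiffOn 𝕜 ∞ (fun z => (h z)⁻¹) O := hh.inv hh0
  have hax := contDiffOn_fderiv_apply hO ha (stdVec 𝕜 true)
  have hay := contDiffOn_fderiv_apply hO ha (stdVec 𝕜 false)
  have hbx := (contDiffOn_fderiv_apply hO hb (stdVec 𝕜 true)).neg
  have hby := contDiffOn_fderiv_apply hO hb (stdVec 𝕜 false)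
  have key : Set.EqOn (fun z => f (a z, b z) * (h z)⁻¹)
      (fun z => fderiv 𝕜 a z (stdVec 𝕜 true) * fderiv 𝕜 b z (stdVec 𝕜 false)
        + fderiv 𝕜 a z (stdVec 𝕜 false) * -fderiv 𝕜 b z (stdVec 𝕜 true)) O := by
    intro z hz
    have h1 := hh0 z hz
    simp only [← hjac z hz, jacobian]
    field_simp
    ring
  have e := wordDeriv_congr hO key l hp
  -- Left side: `f(a, b) / h` vanishes to order `|l| + 1`, so its `l`-derivative is zero. Right
  -- side: the first derivatives of `a` vanish to order `|l|`, so in each product all of `l` falls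
  -- on them.
  rw [(hl.comp hU hf hf0 hO hp ha hb hab).mul hO hp hfab hh' l (Nat.lt_succ_self _),
    wordDeriv_add hO (hax.mul hby) (hay.mul hbx) l hp,
    wordDeriv_mul hO hp hax hby l (hl.fderiv_apply _),
    wordDeriv_mul hO hp hay hbx l (hl.fderiv_apply _)] at e
  rw [wordDeriv_fderiv_apply hO ha _ _ hp, wordDeriv_fderiv_apply hO ha _ _ hp] at e
  rw [jacobian]
  linear_combination -e

theorem exists_iteratedFDeriv_eq_wordDeriv (hO : IsOpen O) (ha : ContDiffOn 𝕜 ∞ a O) (n : ℕ)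
    (m : Fin n → Bool) : ∃ l : List Bool, l.length = n ∧ ∀ z ∈ O,
      iteratedFDeriv 𝕜 n a z (fun j => stdVec 𝕜 (m j)) = wordDeriv l a z := by
  induction n with
  | zero => exact ⟨[], rfl, fun z _ => by simp [wordDeriv]⟩
  | succ n ih =>
    obtain ⟨l, hl, h⟩ := ih (Fin.tail m)
    -- The slot `m 0` of `iteratedFDeriv` is the outermost derivative, hence the last letter of the
    -- word.
    refine ⟨l ++ [m 0], by simp [hl], fun z hz => ?_⟩
    have hd : DifferentiableAt 𝕜 (iteratedFDeriv 𝕜 n a) z :=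
      (ha.contDiffAt (hO.mem_nhds hz)).differentiableAt_iteratedFDeriv (by exact_mod_cast ENat.natCast_lt_top n)
    rw [wordDeriv_append_singleton, iteratedFDeriv_succ_apply_left]
    have he : wordDeriv l a =ᶠ[nhds z]
        fun y => iteratedFDeriv 𝕜 n a y (fun j => stdVec 𝕜 (Fin.tail m j)) :=
      Filter.eventuallyEq_of_mem (hO.mem_nhds hz) fun y hy => (h y hy).symm
    simp only [he.fderiv_eq]
    rw [fderiv_continuousMultilinear_apply_const hd]
    rfl

/-- By multilinearity the Taylor coefficients are determined by their values on basis vectors, which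
are word derivatives; so the Taylor series is zero. -/
theorem eventually_eq_zero_of_forall_wordDeriv (ha : AnalyticAt 𝕜 a p)
    (h : ∀ l, wordDeriv l a p = 0) : ∀ᶠ z in nhds p, a z = 0 := by
  obtain ⟨O, hOs, hO, hp⟩ := eventually_nhds_iff.1 ha.eventually_analyticAt
  have haO : ContDiffOn 𝕜 ∞ a O := fun z hz => (hOs z hz).contDiffAt.contDiffWithinAt
  have h0 : ∀ n, iteratedFDeriv 𝕜 n a p = 0 := by
    intro n
    let B : Module.Basis (Fin 2) 𝕜 (𝕜 × 𝕜) := Module.Basis.finTwoProd 𝕜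
    apply ContinuousMultilinearMap.toMultilinearMap_injective
    refine Module.Basis.ext_multilinear (fun _ => B) fun m => ?_
    obtain ⟨l, -, hl⟩ := exists_iteratedFDeriv_eq_wordDeriv hO haO n fun j => decide (m j = 0)
    have hB : (fun j => B (m j)) = fun j => stdVec 𝕜 (decide (m j = 0)) := by
      funext j
      generalize m j = i
      fin_cases i <;> simp [B, stdVec]
    have := hl p hp
    rw [h, ← hB] at this
    exact this
  obtain ⟨q, r, hq⟩ := ha
  have hball := Metric.eball_mem_nhds p hq.r_pos
  filter_upwards [hball] with z hz
  have hs := hq.hasSum_iteratedFDeriv (y := z - p) (by simpa [edist_eq_enorm_sub] using hz)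
  simp only [h0] at hs
  simpa using hs.unique (by simp)

end Words

end PoissonGeometry

namespace PoissonGeometry

/-! ### Complex differentiable functions of two variables are smooth -/

section Holomorphic

variable {f : ℂ × ℂ → ℂ} {U : Set (ℂ × ℂ)}

/-- Cauchy's estimate for the Fréchet derivative. -/
theorem norm_fderiv_le_of_forall_mem_closedBall {z : ℂ × ℂ} {R M : ℝ} (hR : 0 < R)
    (hf : ∀ w ∈ Metric.closedBall z R, DifferentiableAt ℂ f w)
    (hM : ∀ w ∈ Metric.closedBall z R, ‖f w‖ ≤ M) : ‖fderiv ℂ f z‖ ≤ M / R := by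
  have hM0 : 0 ≤ M := (norm_nonneg _).trans (hM z (Metric.mem_closedBall_self hR.le))
  refine ContinuousLinearMap.opNorm_le_of_unit_norm (𝕜 := ℂ) (by positivity) fun v hv => ?_
  have hmem : ∀ t ∈ Metric.closedBall (0 : ℂ) R, z + t • v ∈ Metric.closedBall z R := by
    intro t ht
    simpa [norm_smul, hv] using ht
  have hline : ∀ t : ℂ, HasDerivAt (fun t : ℂ => z + t • v) v t := fun t => by
    simpa using ((hasDerivAt_id t).smul_const v).const_add z
  have hd : ∀ t ∈ Metric.closedBall (0 : ℂ) R,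
      HasDerivAt (fun t : ℂ => f (z + t • v)) (fderiv ℂ f (z + t • v) v) t := fun t ht =>
    (hf _ (hmem t ht)).hasFDerivAt.comp_hasDerivAt t (hline t)
  have h0 := hd 0 (Metric.mem_closedBall_self hR.le)
  rw [zero_smul, add_zero] at h0
  rw [← h0.deriv]
  refine Complex.norm_deriv_le_of_forall_mem_sphere_norm_le hR ?_ fun t ht =>
    hM _ (hmem t (Metric.sphere_subset_closedBall ht))
  refine DifferentiableOn.diffContOnCl fun t ht => ?_
  exact (hd t (Metric.closure_ball_subset_closedBall ht)).differentiableAt.differentiableWithinAt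

/-- Cauchy's formula on the complex line through `z` in direction `v` writes the directional
derivative as a circle integral of values of `f`. This can be differentiated in `z` under the
integral sign, the domination coming from Cauchy's estimate. -/
theorem differentiableOn_fderiv_apply (hU : IsOpen U) (hf : DifferentiableOn ℂ f U) (v : ℂ × ℂ) :
    DifferentiableOn ℂ (fun z => fderiv ℂ f z v) U := by
  intro z₀ hz₀
  refine DifferentiableAt.differentiableWithinAt ?_
  have hfd : ∀ z ∈ U, DifferentiableAt ℂ f z := fun z hz =>
    (hf z hz).differentiableAt (hU.mem_nhds hz)
  obtain ⟨R', hR', hsub⟩ := Metric.nhds_basis_closedBall.mem_iff.1 (hU.mem_nhds hz₀)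
  -- One `R` for moving the centre `z`, one for the circle in direction `v`, one for the disc in
  -- Cauchy's estimate.
  obtain ⟨R, hR, rfl⟩ : ∃ R, 0 < R ∧ R' = 3 * R := ⟨R' / 3, by positivity, by ring⟩
  obtain ⟨M, hM⟩ := (isCompact_closedBall z₀ (3 * R)).exists_bound_of_continuousOn
    (hf.continuousOn.mono hsub)
  have hbound : ∀ z ∈ Metric.closedBall z₀ (2 * R), ‖fderiv ℂ f z‖ ≤ M / R := by
    intro z hz
    have hs : Metric.closedBall z R ⊆ Metric.closedBall z₀ (3 * R) :=
      Metric.closedBall_subset_closedBall' (by rw [Metric.mem_closedBall] at hz; linarith)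
    exact norm_fderiv_le_of_forall_mem_closedBall hR (fun w hw => hfd w (hsub (hs hw)))
      fun w hw => hM w (hs hw)
  obtain ⟨r, hr, hrv⟩ : ∃ r : ℝ, 0 < r ∧ r * ‖v‖ ≤ R := by
    refine ⟨R / (‖v‖ + 1), by positivity, ?_⟩
    rw [div_mul_eq_mul_div, div_le_iff₀ (by positivity)]
    nlinarith [norm_nonneg v]
  have hmem : ∀ z ∈ Metric.ball z₀ R, ∀ t ∈ Metric.closedBall (0 : ℂ) r,
      z + t • v ∈ Metric.closedBall z₀ (2 * R) := by
    intro z hz t ht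
    rw [mem_closedBall_zero_iff] at ht
    rw [mem_ball_iff_norm] at hz
    rw [mem_closedBall_iff_norm]
    calc ‖z + t • v - z₀‖ = ‖(z - z₀) + t • v‖ := by congr 1; abel
      _ ≤ ‖z - z₀‖ + ‖t‖ * ‖v‖ := (norm_add_le _ _).trans_eq (by rw [norm_smul])
      _ ≤ 2 * R := by nlinarith [norm_nonneg v, mul_le_mul_of_nonneg_right ht (norm_nonneg v)]
  have h23 : Metric.closedBall z₀ (2 * R) ⊆ U :=
    (Metric.closedBall_subset_closedBall (by linarith)).trans hsub
  -- the directional derivative as a Cauchy integral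
  have hcauchy : ∀ z ∈ Metric.ball z₀ R, fderiv ℂ f z v
      = (2 * Real.pi * Complex.I : ℂ)⁻¹ • ∮ t in C(0, r), ((t - 0) ^ 2)⁻¹ • f (z + t • v) := by
    intro z hz
    have hd : ∀ t ∈ Metric.closedBall (0 : ℂ) r,
        HasDerivAt (fun t : ℂ => f (z + t • v)) (fderiv ℂ f (z + t • v) v) t := fun t ht =>
      (hfd _ (h23 (hmem z hz t ht))).hasFDerivAt.comp_hasDerivAt t
        (by simpa using ((hasDerivAt_id t).smul_const v).const_add z)
    have h0 := hd 0 (Metric.mem_closedBall_self hr.le)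
    rw [zero_smul, add_zero] at h0
    rw [← h0.deriv]
    have := DifferentiableOn.deriv_eq_smul_circleIntegral hr (c := 0)
      (f := fun t : ℂ => f (z + t • v))
      (fun t ht => (hd t ht).differentiableAt.differentiableWithinAt)
    simp only [one_div] at this
    rw [this, inv_smul_smul₀ Complex.two_pi_I_ne_zero]
  have hcirc : ∀ θ, circleMap (0 : ℂ) r θ ∈ Metric.closedBall (0 : ℂ) r := fun θ =>
    circleMap_mem_closedBall 0 hr.le θ
  let k : ℝ → ℂ := fun θ => deriv (circleMap 0 r) θ * ((circleMap 0 r θ - 0) ^ 2)⁻¹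
  have hk : Continuous k := by
    have hne : ∀ θ, (circleMap (0 : ℂ) r θ - 0) ^ 2 ≠ 0 := fun θ =>
      pow_ne_zero _ (sub_ne_zero.2 (circleMap_ne_center hr.ne'))
    simp only [k, deriv_circleMap]
    exact ((continuous_circleMap 0 r).mul continuous_const).mul
      ((((continuous_circleMap 0 r).sub continuous_const).pow 2).inv₀ hne)
  have hint : DifferentiableAt ℂ
      (fun z => ∫ θ in (0 : ℝ)..2 * Real.pi, k θ * f (z + circleMap 0 r θ • v)) z₀ := by
    have hcont : ∀ z ∈ Metric.ball z₀ R,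
        Continuous fun θ => k θ * f (z + circleMap 0 r θ • v) := by
      intro z hz
      refine hk.mul (continuous_iff_continuousAt.2 fun θ => ?_)
      refine ContinuousAt.comp (g := f) (f := fun θ => z + circleMap 0 r θ • v)
        (hfd _ (h23 (hmem z hz _ (hcirc θ)))).continuousAt ?_
      exact (continuous_const.add ((continuous_circleMap 0 r).smul continuous_const)).continuousAt
    have hball : Metric.ball z₀ R ∈ nhds z₀ := Metric.ball_mem_nhds z₀ hR
    refine (intervalIntegral.hasFDerivAt_integral_of_dominated_of_fderiv_le
      (bound := fun θ => ‖k θ‖ * (M / R))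
      (F' := fun z θ => k θ • fderiv ℂ f (z + circleMap 0 r θ • v)) hball ?_ ?_ ?_ ?_ ?_
      ?_).differentiableAt
    · filter_upwards [hball] with z hz using (hcont z hz).aestronglyMeasurable
    · exact (hcont z₀ (Metric.mem_ball_self hR)).intervalIntegrable _ _
    -- Continuity of the derivative is not yet known here, but `fderiv` is measurable without it.
    · refine hk.aestronglyMeasurable.smul (Measurable.aestronglyMeasurable ?_)
      exact (measurable_fderiv ℂ f).comp
        (continuous_const.add ((continuous_circleMap 0 r).smul continuous_const)).measurable
    · refine Filter.Eventually.of_forall fun θ _ z hz => ?_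
      rw [norm_smul]
      exact mul_le_mul_of_nonneg_left (hbound _ (hmem z hz _ (hcirc θ))) (norm_nonneg _)
    · exact (hk.norm.mul continuous_const).intervalIntegrable _ _
    · refine Filter.Eventually.of_forall fun θ _ z hz => ?_
      have h1 : HasFDerivAt (fun z : ℂ × ℂ => z + circleMap 0 r θ • v)
          (ContinuousLinearMap.id ℂ (ℂ × ℂ)) z := (hasFDerivAt_id z).add_const _
      have h2 := (hfd _ (h23 (hmem z hz _ (hcirc θ)))).hasFDerivAt.comp z h1
      simpa using h2.const_mul (k θ)
  refine ((hint.const_smul ((2 * Real.pi * Complex.I : ℂ)⁻¹)).congr_of_eventuallyEq ?_)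
  filter_upwards [Metric.ball_mem_nhds z₀ hR] with z hz
  rw [hcauchy z hz]
  simp only [circleIntegral, Pi.smul_apply, k, smul_eq_mul, mul_assoc]

/-- A complex differentiable function on an open subset of `ℂ²` is smooth. -/
theorem contDiffOn_infty_of_differentiableOn (hU : IsOpen U) (hf : DifferentiableOn ℂ f U) :
    ContDiffOn ℂ ∞ f U := by
  rw [contDiffOn_infty]
  intro n
  induction n generalizing f with
  | zero => exact contDiffOn_zero.2 hf.continuousOn
  | succ n ih =>
    have : ((n + 1 : ℕ) : WithTop ℕ∞) = n + 1 := by norm_cast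
    rw [this, contDiffOn_succ_iff_fderiv_of_isOpen hU]
    refine ⟨hf, by simp, ?_⟩
    rw [contDiffOn_clm_apply]
    exact fun v => ih (differentiableOn_fderiv_apply hU hf v)

end Holomorphic

end PoissonGeometry

namespace PoissonGeometry

section Sard

/-! ### Sard's lemma along a regular curve -/

open MeasureTheory

variable {𝕜 : Type*} [RCLike 𝕜]

/-- One-dimensional Sard lemma over `𝕜`. -/
theorem addHaar_image_eq_zero_of_hasDerivAt_zero {c : 𝕜 → 𝕜} {B : Set 𝕜}
    (h : ∀ t ∈ B, HasDerivAt c 0 t) : (Measure.addHaar : Measure 𝕜) (c '' B) = 0 := by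
  refine addHaar_image_eq_zero_of_det_fderivWithin_eq_zero (Measure.addHaar : Measure 𝕜)
    (f' := fun _ => (0 : 𝕜 →L[ℝ] 𝕜)) (fun t ht => ?_) fun t _ => ?_
  · have h1 : HasFDerivAt c (0 : 𝕜 →L[𝕜] 𝕜) t := by simpa using (h t ht).hasFDerivAt
    simpa using (h1.restrictScalars ℝ).hasFDerivWithinAt
  · simp [ContinuousLinearMap.det]

variable {O : Set (𝕜 × 𝕜)} {D Y : 𝕜 × 𝕜 → 𝕜}

/-- The kernel of `ℓ` lies in the line of `w`, on which `dD` is injective, so `(D, ℓ)` is a local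
coordinate system and `D = 0` is a curve `σ` parametrised by `ℓ`. Where `Jac(D, Y) = 0`, `dY` is a
multiple of `dD ≠ 0` and kills `σ'`; the one-dimensional lemma then applies to `Y ∘ σ`. -/
theorem addHaar_image_curve_eq_zero_aux (hO : IsOpen O) (hD : ContDiffOn 𝕜 ∞ D O)
    (hY : ContDiffOn 𝕜 ∞ Y O) {p w : 𝕜 × 𝕜} (hp : p ∈ O) (hw : fderiv 𝕜 D p w ≠ 0)
    (ℓ : 𝕜 × 𝕜 →L[𝕜] 𝕜) (hℓ : ∀ x, ℓ x = 0 → ∃ r : 𝕜, x = r • w) :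
    ∃ N ∈ nhds p, (Measure.addHaar : Measure 𝕜)
      (Y '' {z ∈ O ∩ N | D z = 0 ∧ jacobian D Y z = 0}) = 0 := by
  have hDd : ∀ z ∈ O, HasStrictFDerivAt D (fderiv 𝕜 D z) z := fun z hz =>
    (hD.contDiffAt (hO.mem_nhds hz)).hasStrictFDerivAt (by simp)
  have hYd : ∀ z ∈ O, HasFDerivAt Y (fderiv 𝕜 Y z) z := fun z hz =>
    ((hY.contDiffAt (hO.mem_nhds hz)).differentiableAt (by simp)).hasFDerivAt
  have hequiv : ∀ z, fderiv 𝕜 D z w ≠ 0 → ∃ T : (𝕜 × 𝕜) ≃L[𝕜] (𝕜 × 𝕜),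
      (T : (𝕜 × 𝕜) →L[𝕜] (𝕜 × 𝕜)) = (fderiv 𝕜 D z).prod ℓ := by
    intro z hz
    have hinj : Function.Injective ((fderiv 𝕜 D z).prod ℓ) := by
      rw [injective_iff_map_eq_zero]
      intro x hx
      simp only [ContinuousLinearMap.prod_apply, Prod.mk_eq_zero] at hx
      obtain ⟨r, rfl⟩ := hℓ x hx.2
      have := hx.1
      rw [map_smul, smul_eq_mul, mul_eq_zero] at this
      rw [this.resolve_right hz, zero_smul]
    exact ⟨(LinearEquiv.ofInjectiveEndo ((fderiv 𝕜 D z).prod ℓ : (𝕜 × 𝕜) →ₗ[𝕜] (𝕜 × 𝕜))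
      hinj).toContinuousLinearEquiv, by ext <;> rfl⟩
  obtain ⟨T, hT⟩ := hequiv p hw
  have hΨ : HasStrictFDerivAt (fun z => (D z, ℓ z)) (T : (𝕜 × 𝕜) →L[𝕜] (𝕜 × 𝕜)) p := by
    rw [hT]; exact (hDd p hp).prodMk ℓ.hasStrictFDerivAt
  set e := hΨ.toOpenPartialHomeomorph (fun z => (D z, ℓ z)) with he
  have he' : ∀ z, e z = (D z, ℓ z) := fun z => rfl
  have hcont : ContinuousOn (fun z => fderiv 𝕜 D z w) O :=
    (contDiffOn_fderiv_apply hO hD w).continuousOn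
  refine ⟨e.source ∩ {z | fderiv 𝕜 D z w ≠ 0}, Filter.inter_mem
    (e.open_source.mem_nhds hΨ.mem_toOpenPartialHomeomorph_source)
    ((hcont.continuousAt (hO.mem_nhds hp)).eventually_ne hw), ?_⟩
  set A := {z ∈ O ∩ (e.source ∩ {z | fderiv 𝕜 D z w ≠ 0}) | D z = 0 ∧ jacobian D Y z = 0}
  let σ : 𝕜 → 𝕜 × 𝕜 := fun t => e.symm (0, t)
  have hσ : ∀ z ∈ A, σ (ℓ z) = z := by
    rintro z ⟨⟨_, hz, _⟩, hz0, _⟩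
    have := e.left_inv hz
    rwa [he', hz0] at this
  have hsub : Y '' A ⊆ (Y ∘ σ) '' (ℓ '' A) := by
    rintro _ ⟨z, hz, rfl⟩
    exact ⟨ℓ z, ⟨z, hz, rfl⟩, by rw [Function.comp_apply, hσ z hz]⟩
  refine measure_mono_null hsub (addHaar_image_eq_zero_of_hasDerivAt_zero ?_)
  rintro _ ⟨z, hz, rfl⟩
  have hσz := hσ z hz
  obtain ⟨⟨hzO, hzs, hzw⟩, hz0, hzj⟩ := hz
  obtain ⟨T', hT'⟩ := hequiv z hzw
  have hez : e z = (0, ℓ z) := by rw [he', hz0]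
  have hsymm : HasFDerivAt e.symm (T'.symm : (𝕜 × 𝕜) →L[𝕜] (𝕜 × 𝕜)) (0, ℓ z) := by
    refine e.hasFDerivAt_symm (f' := T') (hez ▸ e.map_source hzs) ?_
    change HasFDerivAt e _ (σ (ℓ z))
    rw [hσz, hT']
    exact ((hDd z hzO).prodMk ℓ.hasStrictFDerivAt).hasFDerivAt
  have hσd : HasDerivAt σ (T'.symm (0, 1)) (ℓ z) :=
    hsymm.comp_hasDerivAt (ℓ z) ((hasDerivAt_const _ _).prodMk (hasDerivAt_id _))
  have hx : fderiv 𝕜 D z (T'.symm (0, 1)) = 0 := by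
    have h1 : ((fderiv 𝕜 D z).prod ℓ) (T'.symm (0, 1)) = (0, 1) := by
      rw [← hT']; exact T'.apply_symm_apply _
    exact congrArg Prod.fst h1
  -- Cramer's rule: were `dY(σ') ≠ 0`, then `dD(σ') = 0` and `Jac(D, Y) = 0` would force both
  -- components of `dD` to vanish.
  have hy : fderiv 𝕜 Y z (T'.symm (0, 1)) = 0 := by
    rw [clm_apply_eq_stdVec] at hx ⊢
    rw [Set.mem_ofPred_eq, clm_apply_eq_stdVec] at hzw
    rw [jacobian] at hzj
    by_contra hne
    have h1 : fderiv 𝕜 D z (stdVec 𝕜 true) = 0 := by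
      refine (mul_eq_zero.1 ?_).resolve_right hne
      linear_combination fderiv 𝕜 Y z (stdVec 𝕜 true) * hx + (T'.symm (0, 1)).2 * hzj
    have h2 : fderiv 𝕜 D z (stdVec 𝕜 false) = 0 := by
      refine (mul_eq_zero.1 ?_).resolve_right hne
      linear_combination fderiv 𝕜 Y z (stdVec 𝕜 false) * hx - (T'.symm (0, 1)).1 * hzj
    simp [h1, h2] at hzw
  rw [← hy]
  have := hYd z hzO
  rw [← hσz] at this
  have h3 := this.comp_hasDerivAt (ℓ z) hσd
  rwa [hσz] at h3

/-- Along the regular part of the curve `D = 0`, the points at which the differentials of `D` and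
`Y` are proportional have a null image under `Y`. -/
theorem addHaar_image_curve_eq_zero (hO : IsOpen O) (hD : ContDiffOn 𝕜 ∞ D O)
    (hY : ContDiffOn 𝕜 ∞ Y O) : (Measure.addHaar : Measure 𝕜)
      (Y '' {z ∈ O | D z = 0 ∧ fderiv 𝕜 D z ≠ 0 ∧ jacobian D Y z = 0}) = 0 := by
  set A := {z ∈ O | D z = 0 ∧ fderiv 𝕜 D z ≠ 0 ∧ jacobian D Y z = 0}
  have hloc : ∀ z ∈ A, ∃ N ∈ nhds z, (Measure.addHaar : Measure 𝕜)
      (Y '' {z ∈ O ∩ N | D z = 0 ∧ jacobian D Y z = 0}) = 0 := by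
    rintro z ⟨hz, -, hz1, -⟩
    by_cases h1 : fderiv 𝕜 D z (1, 0) = 0
    · have h2 : fderiv 𝕜 D z (0, 1) ≠ 0 := fun h2 => hz1 (by ext <;> simpa)
      exact addHaar_image_curve_eq_zero_aux hO hD hY hz h2 (ContinuousLinearMap.fst 𝕜 𝕜 𝕜)
        fun x hx => ⟨x.2, by ext <;> simp_all⟩
    · exact addHaar_image_curve_eq_zero_aux hO hD hY hz h1 (ContinuousLinearMap.snd 𝕜 𝕜 𝕜)
        fun x hx => ⟨x.1, by ext <;> simp_all⟩
  choose! N hN hN0 using hloc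
  obtain ⟨t, htA, htc, hcov⟩ := TopologicalSpace.countable_cover_nhdsWithin
    fun z hz => (mem_nhdsWithin_of_mem_nhds (hN z hz) : N z ∈ nhdsWithin z A)
  refine measure_mono_null (t := ⋃ z ∈ t, Y '' {y ∈ O ∩ N z | D y = 0 ∧ jacobian D Y y = 0}) ?_
    ((measure_biUnion_null_iff htc).2 fun z hz => hN0 z (htA hz))
  rintro _ ⟨y, hy, rfl⟩
  obtain ⟨z, hz, hyz⟩ := Set.mem_iUnion₂.1 (hcov hy)
  exact Set.mem_iUnion₂.2 ⟨z, hz, y, ⟨⟨hy.1, hyz⟩, hy.2.1, hy.2.2.2⟩, rfl⟩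

end Sard

end PoissonGeometry

namespace PoissonGeometry

/-! ### The bracket in a chart of a symplectic surface -/

section LocalForm

variable {𝕜 : Type*} [RCLike 𝕜] {F : Type*} [NormedAddCommGroup F] [NormedSpace 𝕜 F]
  {S : Type*} [TopologicalSpace S] [ChartedSpace F S]

/-- In suitable coordinates near a point of a symplectic surface the bracket of the components of
a map `Φ` is a nowhere vanishing multiple of the Jacobian of `Φ`. -/
theorem exists_chart_jacobian_eq {n : WithTop ℕ∞} (hn : 1 ≤ n) [IsManifold 𝓘(𝕜, F) n S]
    (hF : Module.finrank 𝕜 F = 2) {ϖ : BivectorField 𝕜 F S} (hϖ : ϖ.IsSymplectic n)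
    {Φ : S → 𝕜 × 𝕜} (hΦ : ContMDiff 𝓘(𝕜, F) 𝓘(𝕜, 𝕜 × 𝕜) n Φ) (s₀ : S) :
    ∃ e : OpenPartialHomeomorph S (𝕜 × 𝕜), s₀ ∈ e.source ∧
      ContDiffOn 𝕜 n (Φ ∘ e.symm) e.target ∧
      ∃ h : 𝕜 × 𝕜 → 𝕜, ContDiffOn 𝕜 n h e.target ∧ (∀ z ∈ e.target, h z ≠ 0) ∧
        ∀ z ∈ e.target, h z * jacobian (fun y => (Φ (e.symm y)).1) (fun y => (Φ (e.symm y)).2) z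
          = ϖ.bracket (fun s => (Φ s).1) (fun s => (Φ s).2) (e.symm z) := by
  have hn0 : n ≠ 0 := fun h => by simp [h] at hn
  have : FiniteDimensional 𝕜 F := FiniteDimensional.of_finrank_pos (by omega)
  let L : F ≃L[𝕜] 𝕜 × 𝕜 := ContinuousLinearEquiv.ofFinrankEq (by simp [hF])
  let e : OpenPartialHomeomorph S (𝕜 × 𝕜) :=
    (chartAt F s₀).trans L.toHomeomorph.toOpenPartialHomeomorph
  have hsrc : e.source = (chartAt F s₀).source := by simp [e]
  have he : ContMDiffOn 𝓘(𝕜, F) 𝓘(𝕜, 𝕜 × 𝕜) n e e.source := by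
    rw [hsrc]
    exact L.contDiff.contMDiff.comp_contMDiffOn contMDiffOn_chart
  have hes : ContMDiffOn 𝓘(𝕜, 𝕜 × 𝕜) 𝓘(𝕜, F) n e.symm e.target := by
    refine (contMDiffOn_chart_symm (x := s₀)).comp L.symm.contDiff.contMDiff.contMDiffOn ?_
    intro z hz
    simpa [e] using hz
  have hu : ∀ P : 𝕜 × 𝕜 →L[𝕜] 𝕜,
      ContMDiffOn 𝓘(𝕜, F) 𝓘(𝕜, 𝕜) n (fun s => P (e s)) e.source := fun P =>
    P.contDiff.contMDiff.comp_contMDiffOn he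
  have hΨ : ContDiffOn 𝕜 n (Φ ∘ e.symm) e.target :=
    contMDiffOn_iff_contDiffOn.1 (hΦ.comp_contMDiffOn hes)
  let u : S → 𝕜 := fun s => (e s).1
  let v : S → 𝕜 := fun s => (e s).2
  have hsmooth : ContDiffOn 𝕜 n (fun z => ϖ.bracket u v (e.symm z)) e.target := by
    refine contMDiffOn_iff_contDiffOn.1 (ContMDiffOn.comp (hϖ.isPoisson.contMDiffOn_bracket
      e.source e.open_source u v (hu (ContinuousLinearMap.fst 𝕜 𝕜 𝕜))
      (hu (ContinuousLinearMap.snd 𝕜 𝕜 𝕜))) hes fun z hz => e.map_target hz)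
  have hed : ∀ s ∈ e.source, MDifferentiableAt 𝓘(𝕜, F) 𝓘(𝕜, 𝕜 × 𝕜) e s := fun s hs =>
    (he.contMDiffAt (e.open_source.mem_nhds hs)).mdifferentiableAt hn0
  have hesd : ∀ z ∈ e.target, MDifferentiableAt 𝓘(𝕜, 𝕜 × 𝕜) 𝓘(𝕜, F) e.symm z := fun z hz =>
    (hes.contMDiffAt (e.open_target.mem_nhds hz)).mdifferentiableAt hn0
  have hP : ∀ s ∈ e.source, ∀ P : 𝕜 × 𝕜 →L[𝕜] 𝕜, mvfderiv 𝓘(𝕜, F) (fun s => P (e s)) s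
      = P.comp (mfderiv 𝓘(𝕜, F) 𝓘(𝕜, 𝕜 × 𝕜) e s) := by
    intro s hs P
    have hPd : mvfderiv 𝓘(𝕜, 𝕜 × 𝕜) P (e s) = P := by
      rw [mvfderiv, mfderiv_eq_fderiv, P.fderiv]; rfl
    have := mvfderiv_comp s (g := P) P.differentiableAt.mdifferentiableAt (hed s hs)
    rw [hPd] at this
    exact this
  -- the differential of a function of the coordinates
  have hcomp : ∀ s ∈ e.source, ∀ a : S → 𝕜, MDifferentiableAt 𝓘(𝕜, F) 𝓘(𝕜, 𝕜) a s →
      mvfderiv 𝓘(𝕜, F) a s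
        = fderiv 𝕜 (a ∘ e.symm) (e s) (stdVec 𝕜 true) • mvfderiv 𝓘(𝕜, F) u s
          + fderiv 𝕜 (a ∘ e.symm) (e s) (stdVec 𝕜 false) • mvfderiv 𝓘(𝕜, F) v s := by
    intro s hs a ha
    have h1 : a =ᶠ[nhds s] (a ∘ e.symm) ∘ e := by
      filter_upwards [e.open_source.mem_nhds hs] with y hy
      simp [e.left_inv hy]
    have ha' : MDifferentiableAt 𝓘(𝕜, 𝕜 × 𝕜) 𝓘(𝕜, 𝕜) (a ∘ e.symm) (e s) := by
      refine MDifferentiableAt.comp (e s) ?_ (hesd _ (e.map_source hs))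
      rwa [e.left_inv hs]
    have h2 : mvfderiv 𝓘(𝕜, F) a s = (fderiv 𝕜 (a ∘ e.symm) (e s)).comp
        (mfderiv 𝓘(𝕜, F) 𝓘(𝕜, 𝕜 × 𝕜) e s) := by
      have h3 := mvfderiv_comp s ha' (hed s hs)
      have h4 : mvfderiv 𝓘(𝕜, 𝕜 × 𝕜) (a ∘ e.symm) (e s) = fderiv 𝕜 (a ∘ e.symm) (e s) := by
        rw [mvfderiv, mfderiv_eq_fderiv]; rfl
      rw [h4] at h3
      refine Eq.trans ?_ h3
      rw [mvfderiv, mvfderiv, h1.mfderiv_eq]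
      rfl
    have hu1 := hP s hs (ContinuousLinearMap.fst 𝕜 𝕜 𝕜)
    have hv1 := hP s hs (ContinuousLinearMap.snd 𝕜 𝕜 𝕜)
    simp only [ContinuousLinearMap.coe_fst', ContinuousLinearMap.coe_snd'] at hu1 hv1
    simp only [u, v]
    rw [h2, hu1, hv1]
    ext x
    refine (clm_apply_eq_stdVec (fderiv 𝕜 (a ∘ e.symm) (e s)) _).trans ?_
    rw [mul_comm, mul_comm (Prod.snd _)]
    rfl
  -- The factor `h` is the bracket `{u, v}` of the chart coordinates.
  refine ⟨e, by simp [hsrc], hΨ, fun z => ϖ.bracket u v (e.symm z), hsmooth, ?_, ?_⟩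
  · intro z hz (h0 : ϖ.bracket u v (e.symm z) = 0)
    have hs := e.map_target hz
    rw [BivectorField.bracket] at h0
    generalize e.symm z = s at hs h0
    -- Any covector `β` is the differential at `s` of a linear function `γ` of the chart
    -- coordinates, hence a combination of `du` and `dv`.
    have hspan : ∀ β : Cotangent 𝕜 F s, ∃ c d : 𝕜,
        β = c • mvfderiv 𝓘(𝕜, F) u s + d • mvfderiv 𝓘(𝕜, F) v s := by
      intro β
      let γ : 𝕜 × 𝕜 →L[𝕜] 𝕜 :=
        ContinuousLinearMap.comp (show F →L[𝕜] 𝕜 from β)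
          (mfderiv 𝓘(𝕜, 𝕜 × 𝕜) 𝓘(𝕜, F) e.symm (e s) : 𝕜 × 𝕜 →L[𝕜] F)
      have h1 := hcomp s hs (fun y => γ (e y))
        (((hu γ).contMDiffAt (e.open_source.mem_nhds hs)).mdifferentiableAt hn0)
      rw [hP s hs γ] at h1
      refine ⟨_, _, Eq.trans ?_ h1⟩
      have h2 : (mfderiv 𝓘(𝕜, 𝕜 × 𝕜) 𝓘(𝕜, F) e.symm (e s)).comp
          (mfderiv 𝓘(𝕜, F) 𝓘(𝕜, 𝕜 × 𝕜) e s) = ContinuousLinearMap.id 𝕜 F := by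
        rw [← mfderiv_comp s (hesd _ (e.map_source hs)) (hed s hs)]
        have h3 : e.symm ∘ e =ᶠ[nhds s] id := by
          filter_upwards [e.open_source.mem_nhds hs] with y hy using e.left_inv hy
        rw [h3.mfderiv_eq, mfderiv_id]
        rfl
      ext x
      exact congrArg β (DFunLike.congr_fun h2 x).symm
    -- If `{u, v} = 0`, the form is zero on the span of `du` and `dv`, so nondegeneracy would make
    -- the cotangent space trivial.
    have hzero : ∀ β : Cotangent 𝕜 F s, β = 0 := by
      intro β
      refine (hϖ.nondegenerate s).1 β fun β' => ?_
      obtain ⟨c, d, rfl⟩ := hspan β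
      obtain ⟨c', d', rfl⟩ := hspan β'
      have h0' : ϖ.form s (mvfderiv 𝓘(𝕜, F) v s) (mvfderiv 𝓘(𝕜, F) u s) = 0 := by
        rw [← (ϖ.isAlt s).neg, h0, neg_zero]
      simp [h0, h0', (ϖ.isAlt s).self_eq_zero]
    have h1 := hzero ((ContinuousLinearMap.fst 𝕜 𝕜 𝕜).comp (L : F →L[𝕜] 𝕜 × 𝕜))
    have h2 := DFunLike.congr_fun h1 (L.symm (1, 0))
    have h3 : ((ContinuousLinearMap.fst 𝕜 𝕜 𝕜).comp (L : F →L[𝕜] 𝕜 × 𝕜)) (L.symm (1, 0)) = 1 := by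
      simp
    exact one_ne_zero (h3.symm.trans h2)
  · intro z hz
    have hs := e.map_target hz
    have hΦd := hΦ.mdifferentiableAt hn0 (x := e.symm z)
    have h1 := hcomp _ hs (fun s => (Φ s).1)
      ((contDiff_fst.contMDiff.comp hΦ).mdifferentiableAt hn0)
    have h2 := hcomp _ hs (fun s => (Φ s).2)
      ((contDiff_snd.contMDiff.comp hΦ).mdifferentiableAt hn0)
    rw [e.right_inv hz] at h1 h2
    simp only [BivectorField.bracket, h1, h2, map_add, map_smul, LinearMap.add_apply,
      LinearMap.smul_apply, smul_eq_mul, (ϖ.isAlt (e.symm z)).self_eq_zero]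
    rw [← (ϖ.isAlt (e.symm z)).neg (mvfderiv 𝓘(𝕜, F) u (e.symm z)), jacobian]
    simp only [Function.comp_def]
    ring

end LocalForm

end PoissonGeometry

namespace PoissonGeometry

/-! ### Brackets of functions pulled back to a resolution -/

section Resolution

variable {𝕜 : Type*} [RCLike 𝕜] {F : Type*} [NormedAddCommGroup F] [NormedSpace 𝕜 F]
  {S : Type*} [TopologicalSpace S] [ChartedSpace F S]

theorem IsSymplecticResolution.bracket_comp {n : WithTop ℕ∞} (hn : n ≠ 0)
    {E : Type*} [NormedAddCommGroup E] [NormedSpace 𝕜 E] {M : Type*} [TopologicalSpace M]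
    [ChartedSpace E M] {π : BivectorField 𝕜 E M} {ϖ : BivectorField 𝕜 F S} {φ : S → M}
    (h : IsSymplecticResolution n π ϖ φ) {a b : M → 𝕜} (s : S)
    (ha : MDifferentiableAt 𝓘(𝕜, E) 𝓘(𝕜, 𝕜) a (φ s))
    (hb : MDifferentiableAt 𝓘(𝕜, E) 𝓘(𝕜, 𝕜) b (φ s)) :
    ϖ.bracket (a ∘ φ) (b ∘ φ) s = π.bracket a b (φ s) := by
  have hφ := h.contMDiff.mdifferentiableAt hn (x := s)
  rw [BivectorField.bracket, mvfderiv_comp s ha hφ, mvfderiv_comp s hb hφ, h.form_comp]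
  rfl

end Resolution

/-! ### Analytic and holomorphic resolutions -/

section Analytic

open MeasureTheory

variable {𝕜 : Type*} [RCLike 𝕜] {S : Type*} [TopologicalSpace S]

/-- The points at which a function vanishes locally form a clopen set, if the function is analytic
in local coordinates. -/
theorem isClopen_setOf_eventually_eq_zero {a : S → 𝕜}
    (hloc : ∀ s : S, ∃ e : OpenPartialHomeomorph S (𝕜 × 𝕜), s ∈ e.source ∧
      AnalyticOnNhd 𝕜 (fun z => a (e.symm z)) e.target) :
    IsClopen {s | ∀ᶠ y in nhds s, a y = 0} := by
  refine ⟨isClosed_of_closure_subset fun s hs => ?_, isOpen_setOfPred_eventually_nhds⟩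
  obtain ⟨e, hse, ha⟩ := hloc s
  obtain ⟨r, hr, hball⟩ := Metric.isOpen_iff.1 e.open_target (e s) (e.map_source hse)
  have hN : e.source ∩ e ⁻¹' Metric.ball (e s) r ∈ nhds s :=
    (e.isOpen_inter_preimage Metric.isOpen_ball).mem_nhds ⟨hse, Metric.mem_ball_self hr⟩
  obtain ⟨y, ⟨hye, hyr⟩, hy⟩ := mem_closure_iff_nhds.1 hs _ hN
  have hy' : (fun z => a (e.symm z)) =ᶠ[nhds (e y)] 0 := by
    have := e.continuousAt_symm (e.map_source hye)
    rw [ContinuousAt, e.left_inv hye] at this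
    exact this.eventually hy
  have hzero := (ha.mono hball).eqOn_zero_of_preconnected_of_eventuallyEq_zero
    (convex_ball (e s) r).isPreconnected hyr hy'
  filter_upwards [hN] with x hx
  simpa [e.left_inv hx.1] using hzero hx.2

/-- Let `(X, Y)` be an analytic map whose Jacobian is, up to a nowhere vanishing factor, the pullback
of a function that vanishes on the line `x = 0`. If `X` vanishes identically nowhere, then the
image under `Y` of the zero set of `X` is null. -/
theorem addHaar_image_zeros_eq_zero {U O : Set (𝕜 × 𝕜)} (hU : IsOpen U) {f h X Y : 𝕜 × 𝕜 → 𝕜}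
    (hf : ContDiffOn 𝕜 ∞ f U) (hf0 : ∀ z ∈ U, z.1 = 0 → f z = 0) (hO : IsOpen O)
    (hX : AnalyticOnNhd 𝕜 X O) (hY : ContDiffOn 𝕜 ∞ Y O) (hXY : ∀ z ∈ O, (X z, Y z) ∈ U)
    (hh : ContDiffOn 𝕜 ∞ h O) (hh0 : ∀ z ∈ O, h z ≠ 0)
    (hjac : ∀ z ∈ O, h z * jacobian X Y z = f (X z, Y z))
    (hne : ∀ z ∈ O, ¬ ∀ᶠ y in nhds z, X y = 0) :
    (Measure.addHaar : Measure 𝕜) (Y '' {z ∈ O | X z = 0}) = 0 := by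
  have hX' : ContDiffOn 𝕜 ∞ X O := fun z hz => (hX z hz).contDiffAt.contDiffWithinAt
  refine measure_mono_null (t := ⋃ l : List Bool, Y '' {z ∈ O | wordDeriv l X z = 0 ∧
    fderiv 𝕜 (wordDeriv l X) z ≠ 0 ∧ jacobian (wordDeriv l X) Y z = 0}) ?_
    (measure_iUnion_null fun l =>
      addHaar_image_curve_eq_zero hO (contDiffOn_wordDeriv hO l hX') hY)
  rintro _ ⟨z, ⟨hz, hz0⟩, rfl⟩
  have hex : ∃ k, ∃ l : List Bool, l.length = k ∧ wordDeriv l X z ≠ 0 := by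
    by_contra! hcon
    exact hne z hz (eventually_eq_zero_of_forall_wordDeriv (hX z hz) fun l => hcon _ l rfl)
  classical
  obtain ⟨l', hl', hne'⟩ := Nat.find_spec hex
  have hmin : VanishesToOrder l'.length X z := fun l hl => by
    by_contra hcon
    exact Nat.find_min hex (hl' ▸ hl) ⟨l, rfl, hcon⟩
  -- The shortest word with nonzero derivative is not empty, as `X z = 0`. Without its last letter
  -- it gives `D = ∂_l X` with `D z = 0` by minimality and `∂_i D z ≠ 0`.
  obtain rfl | ⟨l, i, rfl⟩ := l'.eq_nil_or_concat
  · exact absurd hz0 hne'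
  rw [List.concat_eq_append] at hmin hne'
  rw [List.length_append, List.length_singleton] at hmin
  rw [wordDeriv_append_singleton] at hne'
  refine Set.mem_iUnion.2 ⟨l, z, ⟨hz, hmin l (Nat.lt_succ_self _), fun h0 => hne' ?_,
    jacobian_wordDeriv_eq_zero hU hf hf0 hO hz hX' hY hXY hh hh0 hjac l hmin⟩, rfl⟩
  simp [h0]

variable {F : Type*} [NormedAddCommGroup F] [NormedSpace 𝕜 F] [ChartedSpace F S]

/-- There is no analytic symplectic map from a connected second countable symplectic surface onto
an open subset of the plane with a Poisson structure that vanishes on the line `x = 0`. -/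
theorem not_connectedSpace_of_analytic [SecondCountableTopology S] [IsManifold 𝓘(𝕜, F) ω S]
    (hF : Module.finrank 𝕜 F = 2) {ϖ : BivectorField 𝕜 F S} (hϖ : ϖ.IsSymplectic ω)
    {U : Set (𝕜 × 𝕜)} (hU : IsOpen U) (h0 : (0, 0) ∈ U) {f : 𝕜 × 𝕜 → 𝕜}
    (hf : ContDiffOn 𝕜 ∞ f U) (hf0 : ∀ z ∈ U, z.1 = 0 → f z = 0)
    {Φ : S → 𝕜 × 𝕜} (hΦ : ContMDiff 𝓘(𝕜, F) 𝓘(𝕜, 𝕜 × 𝕜) ω Φ) (hrange : Set.range Φ = U)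
    (hb : ∀ s, ϖ.bracket (fun s => (Φ s).1) (fun s => (Φ s).2) s = f (Φ s)) :
    ¬ ConnectedSpace S := by
  intro hconn
  choose e hse he h hh hh0 hjac using exists_chart_jacobian_eq le_top hF hϖ hΦ
  have hX : ∀ s, AnalyticOnNhd 𝕜 (fun z => (Φ ((e s).symm z)).1) (e s).target := fun s z hz =>
    ((he s).contDiffAt ((e s).open_target.mem_nhds hz)).fst.analyticAt
  have hY : ∀ s, ContDiffOn 𝕜 ∞ (fun z => (Φ ((e s).symm z)).2) (e s).target := fun s =>
    ((he s).of_le le_top).snd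
  have hclopen := isClopen_setOf_eventually_eq_zero (a := fun s => (Φ s).1)
    fun s => ⟨e s, hse s, hX s⟩
  -- By connectedness the alternative is `X = 0` everywhere, but the range contains points `(x, 0)`
  -- with `x ≠ 0`.
  have hne : ∀ s, ¬ ∀ᶠ y in nhds s, (Φ y).1 = 0 := by
    rcases isClopen_iff.1 hclopen with hZ | hZ
    · exact fun s hs => (hZ ▸ hs : s ∈ (∅ : Set S))
    · have hzero : ∀ s, (Φ s).1 = 0 := fun s =>
        Filter.Eventually.self_of_nhds (p := fun y => (Φ y).1 = 0)
          (show s ∈ {s | ∀ᶠ y in nhds s, (Φ y).1 = 0} from hZ ▸ Set.mem_univ s)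
      have hev : ∀ᶠ x in nhdsWithin (0 : 𝕜) {0}ᶜ, (x, (0 : 𝕜)) ∈ U :=
        nhdsWithin_le_nhds ((Continuous.prodMk_left (0 : 𝕜)).continuousAt.eventually
          (hU.mem_nhds h0))
      obtain ⟨x, hx, hx0⟩ := (hev.and self_mem_nhdsWithin).exists
      obtain ⟨s, hs⟩ := hrange.symm ▸ hx
      exact absurd (by simpa [hs] using hzero s) hx0
  have hnull : ∀ s, (Measure.addHaar : Measure 𝕜) ((fun z => (Φ ((e s).symm z)).2) ''
      {z ∈ (e s).target | (Φ ((e s).symm z)).1 = 0}) = 0 := by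
    intro s
    refine addHaar_image_zeros_eq_zero hU hf hf0 (e s).open_target (hX s) (hY s)
      (fun z _ => hrange ▸ Set.mem_range_self _) ((hh s).of_le le_top) (hh0 s)
      (fun z hz => (hjac s z hz).trans (hb _)) fun z hz hz0 => hne ((e s).symm z) ?_
    have hc := (e s).continuousAt ((e s).map_target hz)
    rw [ContinuousAt, (e s).right_inv hz] at hc
    filter_upwards [hc.eventually hz0, (e s).open_source.mem_nhds ((e s).map_target hz)]
      with y hy hys
    simpa [(e s).left_inv hys] using hy
  obtain ⟨t, htc, ht⟩ := TopologicalSpace.countable_cover_nhds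
    fun s => (e s).open_source.mem_nhds (hse s)
  -- This slice is open and nonempty, so of positive measure, yet it is covered by countably many
  -- null sets.
  have hV : IsOpen {y : 𝕜 | ((0 : 𝕜), y) ∈ U} := hU.preimage (Continuous.prodMk_right (0 : 𝕜))
  refine (hV.measure_pos (Measure.addHaar : Measure 𝕜) ⟨0, h0⟩).ne' ?_
  refine measure_mono_null ?_ ((measure_biUnion_null_iff htc).2 fun s _ => hnull s)
  intro y hy
  obtain ⟨s, hs⟩ : ((0 : 𝕜), y) ∈ Set.range Φ := hrange.symm ▸ hy
  obtain ⟨s', hs', hss'⟩ := Set.mem_iUnion₂.1 (ht.symm ▸ Set.mem_univ s : s ∈ ⋃ x ∈ t, (e x).source)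
  refine Set.mem_iUnion₂.2 ⟨s', hs', e s' s, ⟨(e s').map_source hss', ?_⟩, ?_⟩
  · rw [(e s').left_inv hss', hs]
  · simp only [(e s').left_inv hss', hs]

end Analytic

/-! ### Proper smooth resolutions: an area estimate -/

section Proper

open MeasureTheory

theorem det_fderiv_eq_jacobian {Ψ : ℝ × ℝ → ℝ × ℝ} {z : ℝ × ℝ} (h : DifferentiableAt ℝ Ψ z) :
    (fderiv ℝ Ψ z).det = jacobian (fun y => (Ψ y).1) (fun y => (Ψ y).2) z := by
  rw [jacobian, fderiv.fst h, fderiv.snd h, ContinuousLinearMap.det,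
    ← LinearMap.det_toMatrix (Module.Basis.finTwoProd ℝ), Matrix.det_fin_two]
  simp [LinearMap.toMatrix_apply, stdVec]

/-- If the Jacobian of `Ψ` is `O(x ∘ Ψ)`, then the area of the part of the image of a compact set
that lies in the strip `0 < x ≤ ε` is `o(ε)`. -/
theorem eventually_volume_image_strip_le {O K : Set (ℝ × ℝ)} (hO : IsOpen O) (hK : IsCompact K)
    (hKO : K ⊆ O) {Ψ : ℝ × ℝ → ℝ × ℝ} (hΨ : ContDiffOn ℝ ∞ Ψ O) {C : ℝ}
    (hC : ∀ z ∈ K, |jacobian (fun y => (Ψ y).1) (fun y => (Ψ y).2) z| ≤ C * |(Ψ z).1|)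
    {δ : ENNReal} (hδ : 0 < δ) :
    ∀ᶠ ε in nhdsWithin (0 : ℝ) (Set.Ioi 0),
      volume (Ψ '' {z ∈ K | (Ψ z).1 ∈ Set.Ioc 0 ε}) ≤ δ * ENNReal.ofReal ε := by
  -- The bound does not force `C ≥ 0`, for instance when `K` is empty.
  wlog hC0 : 0 ≤ C generalizing C
  · exact this (C := |C|) (fun z hz => (hC z hz).trans (by gcongr; exact le_abs_self C)) (abs_nonneg C)
  have hcont : ContinuousOn (fun z => (Ψ z).1) K := (hΨ.continuousOn.mono hKO).fst
  let A : ℝ → Set (ℝ × ℝ) := fun ε => {z ∈ K | (Ψ z).1 ∈ Set.Ioc 0 ε}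
  have hmeas : ∀ ε, MeasurableSet (A ε) := by
    intro ε
    have h1 := hcont.preimage_isClosed_of_isClosed hK.isClosed (isClosed_Iic (a := ε))
    have h2 := hcont.preimage_isClosed_of_isClosed hK.isClosed (isClosed_Iic (a := (0 : ℝ)))
    have : A ε = (K ∩ (fun z => (Ψ z).1) ⁻¹' Set.Iic ε) \ (K ∩ (fun z => (Ψ z).1) ⁻¹' Set.Iic 0) := by
      ext z
      simp only [A, Set.mem_ofPred_eq, Set.mem_sdiff, Set.mem_inter_iff, Set.mem_preimage,
        Set.mem_Iic, Set.mem_Ioc, not_and, not_le]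
      tauto
    rw [this]
    exact h1.measurableSet.diff h2.measurableSet
  -- The strict inequality `0 < x` matters: the zero set of `x ∘ Ψ` may have positive area, but it
  -- is left out. Hence the area of `A ε` tends to `0`, which improves `O(ε)` to `o(ε)`.
  have hempty : ⋂ ε > (0 : ℝ), A ε = ∅ := by
    refine Set.eq_empty_of_forall_notMem fun z hz => ?_
    rw [Set.mem_iInter₂] at hz
    have h1 := (hz 1 one_pos).2.1
    have h2 := (hz ((Ψ z).1 / 2) (half_pos h1)).2.2
    linarith
  have hlim : Filter.Tendsto (fun ε => ENNReal.ofReal C * volume (A ε))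
      (nhdsWithin (0 : ℝ) (Set.Ioi 0)) (nhds 0) := by
    have := tendsto_measure_biInter_gt (μ := (volume : Measure (ℝ × ℝ))) (s := A) (a := 0)
      (fun ε _ => (hmeas ε).nullMeasurableSet)
      (fun i j _ hij z hz => ⟨hz.1, hz.2.1, hz.2.2.trans hij⟩)
      ⟨1, one_pos, ((measure_mono fun z hz => hz.1).trans_lt hK.measure_lt_top).ne⟩
    rw [hempty, measure_empty] at this
    simpa using ENNReal.Tendsto.const_mul this (Or.inr ENNReal.ofReal_ne_top)
  filter_upwards [hlim.eventually (Iic_mem_nhds hδ), self_mem_nhdsWithin] with ε hε hε0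
  have hdiff : ∀ z ∈ K, DifferentiableAt ℝ Ψ z := fun z hz =>
    (hΨ.contDiffAt (hO.mem_nhds (hKO hz))).differentiableAt (by simp)
  calc volume (Ψ '' A ε)
      ≤ ∫⁻ z in A ε, ENNReal.ofReal |(fderiv ℝ Ψ z).det| :=
        addHaar_image_le_lintegral_abs_det_fderiv _ (hmeas ε) fun z hz =>
          (hdiff z hz.1).hasFDerivAt.hasFDerivWithinAt
    _ ≤ ∫⁻ _ in A ε, ENNReal.ofReal (C * ε) := by
        refine setLIntegral_mono measurable_const fun z hz => ENNReal.ofReal_le_ofReal ?_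
        rw [det_fderiv_eq_jacobian (hdiff z hz.1)]
        refine (hC z hz.1).trans (mul_le_mul_of_nonneg_left ?_ hC0)
        rw [abs_of_pos hz.2.1]
        exact hz.2.2
    _ = ENNReal.ofReal C * volume (A ε) * ENNReal.ofReal ε := by
        rw [setLIntegral_const, ENNReal.ofReal_mul hC0]; ring
    _ ≤ δ * ENNReal.ofReal ε := by gcongr

variable {F : Type*} [NormedAddCommGroup F] [NormedSpace ℝ F] {S : Type*} [TopologicalSpace S]
  [ChartedSpace F S]

/-- There is no proper symplectic map from a symplectic surface onto the plane with the Poisson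
structure `{x, y} = x g`: the area of the preimage of a compact set would be infinite. -/
theorem not_isProperMap_of_smooth [IsManifold 𝓘(ℝ, F) ∞ S]
    (hF : Module.finrank ℝ F = 2) {ϖ : BivectorField ℝ F S} (hϖ : ϖ.IsSymplectic ∞)
    {g : ℝ × ℝ → ℝ} (hg : Continuous g)
    {Φ : S → ℝ × ℝ} (hΦ : ContMDiff 𝓘(ℝ, F) 𝓘(ℝ, ℝ × ℝ) ∞ Φ) (hsurj : Function.Surjective Φ)
    (hb : ∀ s, ϖ.bracket (fun s => (Φ s).1) (fun s => (Φ s).2) s = (Φ s).1 * g (Φ s)) :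
    ¬ IsProperMap Φ := by
  intro hproper
  have hcompact : IsCompact (Φ ⁻¹' (Set.Icc 0 1 ×ˢ Set.Icc 0 1)) :=
    hproper.isCompact_preimage (isCompact_Icc.prod isCompact_Icc)
  have key : ∀ δ : ENNReal, 0 < δ → ∀ᶠ ε in nhdsWithin (0 : ℝ) (Set.Ioi 0),
      volume (Φ '' {s ∈ Φ ⁻¹' (Set.Icc 0 1 ×ˢ Set.Icc 0 1) | (Φ s).1 ∈ Set.Ioc 0 ε})
        ≤ δ * ENNReal.ofReal ε := by
    -- Areas are measured in the image, so the estimate makes sense without a measure on `S`; being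
    -- `o(ε)`, it passes to subsets and finite unions and need only be checked locally.
    refine hcompact.induction_on (p := fun N => ∀ δ : ENNReal, 0 < δ →
      ∀ᶠ ε in nhdsWithin (0 : ℝ) (Set.Ioi 0),
        volume (Φ '' {s ∈ N | (Φ s).1 ∈ Set.Ioc 0 ε}) ≤ δ * ENNReal.ofReal ε) ?_ ?_ ?_ ?_
    · intro δ _
      simp
    · intro N N' hN h δ hδ
      filter_upwards [h δ hδ] with ε hε
      exact (measure_mono (Set.image_mono
        (fun s hs => ⟨hN hs.1, hs.2⟩ : {s ∈ N | (Φ s).1 ∈ Set.Ioc 0 ε} ⊆ {s ∈ N' | (Φ s).1 ∈ Set.Ioc 0 ε}))).trans hε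
    · intro N N' h h' δ hδ
      filter_upwards [h (δ / 2) (ENNReal.half_pos hδ.ne'),
        h' (δ / 2) (ENNReal.half_pos hδ.ne')] with ε hε hε'
      have hsub : Φ '' {s ∈ N ∪ N' | (Φ s).1 ∈ Set.Ioc 0 ε} ⊆
          Φ '' {s ∈ N | (Φ s).1 ∈ Set.Ioc 0 ε} ∪ Φ '' {s ∈ N' | (Φ s).1 ∈ Set.Ioc 0 ε} := by
        rintro _ ⟨s, ⟨hs | hs, hs'⟩, rfl⟩
        exacts [Or.inl ⟨s, ⟨hs, hs'⟩, rfl⟩, Or.inr ⟨s, ⟨hs, hs'⟩, rfl⟩]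
      refine (measure_mono hsub).trans ((measure_union_le _ _).trans ((add_le_add hε hε').trans_eq ?_))
      rw [← add_mul, ENNReal.add_halves]
    · intro s _
      obtain ⟨e, hse, he, h, hh, hh0, hjac⟩ := exists_chart_jacobian_eq (by simp) hF hϖ hΦ s
      obtain ⟨r, hr, hball⟩ := Metric.nhds_basis_closedBall.mem_iff.1
        (e.open_target.mem_nhds (e.map_source hse))
      have hK := isCompact_closedBall (e s) r
      -- In the chart the Jacobian is `X · (g ∘ Φ) / h`, so `C` bounds `(g ∘ Φ) / h` on the closed
      -- ball.
      obtain ⟨C, hC⟩ := hK.exists_bound_of_continuousOn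
        (f := fun z => (h z)⁻¹ * g (Φ (e.symm z)))
        (((hh.continuousOn.inv₀ hh0).mul (hg.comp_continuousOn he.continuousOn)).mono hball)
      refine ⟨e.source ∩ e ⁻¹' Metric.closedBall (e s) r, mem_nhdsWithin_of_mem_nhds
        (Filter.inter_mem (e.open_source.mem_nhds hse)
          (e.continuousAt hse (Metric.closedBall_mem_nhds _ hr))), fun δ hδ => ?_⟩
      have hCjac : ∀ z ∈ Metric.closedBall (e s) r,
          |jacobian (fun y => ((Φ ∘ e.symm) y).1) (fun y => ((Φ ∘ e.symm) y).2) z|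
            ≤ C * |((Φ ∘ e.symm) z).1| := by
        intro z hz
        have h1 := hjac z (hball hz)
        rw [hb] at h1
        have h2 : jacobian (fun y => ((Φ ∘ e.symm) y).1) (fun y => ((Φ ∘ e.symm) y).2) z
            = ((h z)⁻¹ * g (Φ (e.symm z))) * (Φ (e.symm z)).1 := by
          have := hh0 z (hball hz)
          field_simp
          simp only [Function.comp_apply]
          linear_combination h1
        rw [h2, abs_mul]
        exact mul_le_mul_of_nonneg_right (hC z hz) (abs_nonneg _)
      filter_upwards [eventually_volume_image_strip_le e.open_target hK hball he hCjac hδ] with ε hε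
      refine (measure_mono ?_).trans hε
      rintro _ ⟨y, ⟨⟨hy, hyr⟩, hy0⟩, rfl⟩
      exact ⟨e y, ⟨hyr, by simpa [e.left_inv hy] using hy0⟩, by simp [e.left_inv hy]⟩
  have hlt : ∀ᶠ ε in nhdsWithin (0 : ℝ) (Set.Ioi 0), ε ≤ 1 :=
    nhdsWithin_le_nhds (Iic_mem_nhds one_pos)
  -- Any `δ < 1` would do; `ε ≤ 1` keeps the strip inside the unit square.
  obtain ⟨ε, hε, hε1, hε0⟩ := ((key (1 / 2) (by simp)).and
    (hlt.and self_mem_nhdsWithin)).exists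
  have hsub : Set.Ioc (0 : ℝ) ε ×ˢ Set.Icc (0 : ℝ) 1 ⊆
      Φ '' {s ∈ Φ ⁻¹' (Set.Icc 0 1 ×ˢ Set.Icc 0 1) | (Φ s).1 ∈ Set.Ioc 0 ε} := by
    rintro z ⟨hz1, hz2⟩
    obtain ⟨s, rfl⟩ := hsurj z
    exact ⟨s, ⟨⟨⟨hz1.1.le, hz1.2.trans hε1⟩, hz2⟩, hz1⟩, rfl⟩
  have hle := (measure_mono hsub).trans hε
  rw [Measure.volume_eq_prod, Measure.prod_prod, Real.volume_Ioc, Real.volume_Icc, sub_zero,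
    sub_zero, ENNReal.ofReal_one, mul_one] at hle
  have hpos : 0 < ENNReal.ofReal ε := ENNReal.ofReal_pos.2 hε0
  have : (1 / 2 : ENNReal) * ENNReal.ofReal ε < ENNReal.ofReal ε := by
    rw [one_div, mul_comm, ← div_eq_mul_inv]
    exact ENNReal.half_lt_self hpos.ne' ENNReal.ofReal_ne_top
  exact absurd hle this.not_ge

end Proper

end PoissonGeometry

/-! ### The three cases -/

theorem mainTheorem2 :
    -- smooth case: no proper resolution
    (∀ g : ℝ × ℝ → ℝ, ContDiff ℝ ∞ g → (∀ z : ℝ × ℝ, z.1 ≠ 0 → g z ≠ 0) →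
      ∀ (F : Type v) [NormedAddCommGroup F] [NormedSpace ℝ F]
        (S : Type w) [TopologicalSpace S] [T2Space S] [ChartedSpace F S] [IsManifold 𝓘(ℝ, F) ∞ S]
        (ϖ : PoissonGeometry.BivectorField ℝ F S) (φ : S → ℝ × ℝ),
        PoissonGeometry.IsSymplecticResolution ∞
          (PoissonGeometry.planarBivector fun z : ℝ × ℝ => z.1 * g z) ϖ φ →
        ¬ IsProperMap φ) ∧
    -- real analytic case: no connected resolution
    (∀ g : ℝ × ℝ → ℝ, ContDiff ℝ ∞ g → (∀ z : ℝ × ℝ, z.1 ≠ 0 → g z ≠ 0) →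
      AnalyticOnNhd ℝ (fun z : ℝ × ℝ => z.1 * g z) Set.univ →
      ∀ (F : Type v) [NormedAddCommGroup F] [NormedSpace ℝ F]
        (S : Type w) [TopologicalSpace S] [T2Space S] [SecondCountableTopology S]
        [ChartedSpace F S] [IsManifold 𝓘(ℝ, F) ω S]
        (ϖ : PoissonGeometry.BivectorField ℝ F S) (φ : S → ℝ × ℝ),
        PoissonGeometry.IsSymplecticResolution ω
          (PoissonGeometry.planarBivector fun z : ℝ × ℝ => z.1 * g z) ϖ φ →
        ¬ ConnectedSpace S) ∧
    -- holomorphic case: no connected resolution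
    (∀ U : TopologicalSpace.Opens (ℂ × ℂ), (0, 0) ∈ U →
      ∀ g : ℂ × ℂ → ℂ, (∀ z ∈ U, z.1 ≠ 0 → g z ≠ 0) →
      DifferentiableOn ℂ (fun z : ℂ × ℂ => z.1 * g z) U →
      ∀ (F : Type v) [NormedAddCommGroup F] [NormedSpace ℂ F]
        (S : Type w) [TopologicalSpace S] [T2Space S] [SecondCountableTopology S]
        [ChartedSpace F S] [IsManifold 𝓘(ℂ, F) ω S]
        (ϖ : PoissonGeometry.BivectorField ℂ F S) (φ : S → U),
        PoissonGeometry.IsSymplecticResolution ω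
          (PoissonGeometry.planarBivector fun z : U => (z : ℂ × ℂ).1 * g z) ϖ φ →
        ¬ ConnectedSpace S) := by
  refine ⟨fun g hg _ F _ _ S _ _ _ _ ϖ φ h => ?_, fun g hg _ _ F _ _ S _ _ _ _ _ ϖ φ h => ?_,
    fun U h0 g _ hd F _ _ S _ _ _ _ _ ϖ φ h => ?_⟩
  · refine PoissonGeometry.not_isProperMap_of_smooth (h.finrank_eq.trans (by simp))
      h.isSymplectic hg.continuous h.contMDiff h.surjective fun s => ?_
    exact (h.bracket_comp (by simp) s (a := Prod.fst) (b := Prod.snd)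
      differentiableAt_fst.mdifferentiableAt differentiableAt_snd.mdifferentiableAt).trans
      (PoissonGeometry.planarBivector_bracket_coord _ _)
  · refine PoissonGeometry.not_connectedSpace_of_analytic (h.finrank_eq.trans (by simp))
      h.isSymplectic isOpen_univ (Set.mem_univ _) (f := fun z => z.1 * g z)
      (contDiff_fst.mul hg).contDiffOn (fun z _ hz => by simp [hz]) h.contMDiff
      h.surjective.range_eq fun s => ?_
    exact (h.bracket_comp (by simp) s (a := Prod.fst) (b := Prod.snd)
      differentiableAt_fst.mdifferentiableAt differentiableAt_snd.mdifferentiableAt).trans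
      (PoissonGeometry.planarBivector_bracket_coord _ _)
  -- The resolution takes values in `U`; composing with the inclusion gives a map to `ℂ²` with range
  -- `U`.
  · have hval : ContMDiff 𝓘(ℂ, ℂ × ℂ) 𝓘(ℂ, ℂ × ℂ) ω (Subtype.val : U → ℂ × ℂ) :=
      contMDiff_subtype_val
    refine PoissonGeometry.not_connectedSpace_of_analytic (Φ := Subtype.val ∘ φ)
      (h.finrank_eq.trans (by simp)) h.isSymplectic U.isOpen h0 (f := fun z => z.1 * g z)
      (PoissonGeometry.contDiffOn_infty_of_differentiableOn U.isOpen hd)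
      (fun z _ hz => by simp [hz]) (hval.comp h.contMDiff)
      (by rw [h.surjective.range_comp]; exact Subtype.range_coe) fun s => ?_
    exact (h.bracket_comp (by simp) s
      (a := fun p : U => (p : ℂ × ℂ).1) (b := fun p : U => (p : ℂ × ℂ).2)
      ((contDiff_fst.contMDiff.comp hval).mdifferentiableAt (by simp))
      ((contDiff_snd.contMDiff.comp hval).mdifferentiableAt (by simp))).trans
      (PoissonGeometry.planarBivector_bracket_coord_opens _ _ _)
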